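/- Let $\mathcal M$ be the set of monomials $M=\prod_{i\in\{1,2\},\,n\in\mathbb Z}Y_i(n)^{y_{i,n}}$ in commuting variables $Y_i(n)$, with integer exponents, almost all zero. Let $\Lambda_1,\Lambda_2$ be the fundamental weights of $G_2$ and $\mathrm{wt}(M)=\sum_{i,n}y_{i,n}\Lambda_i$. Put $$\varphi_i(M)=\max_{n\in\mathbb Z}\sum_{k\le n}y_{i,k},\qquad \varepsilon_i(M)=\max_{n\in\mathbb Z}\Big(-\sum_{k>n}y_{i,k}\Big),$$ let $n_f$ (if $\varphi_i(M)>0$) and $n_e$ (if $\varepsilon_i(M)>0$) be the smallest and the largest $n\in\mathbb Z$ with $\varphi_i(M)=\sum_{k\le n}y_{i,k}$, and let $$A_1(n)=Y_1(n)Y_1(n+1)Y_2(n)^{-1},\qquad A_2(n)=Y_2(n)Y_2(n+1)Y_1(n+1)^{-3}.$$ The Kashiwara operators are $\tilde f_iM=A_i(n_f)^{-1}M$ if $\varphi_i(M)>0$ and $\tilde f_iM=0$ otherwise, and $\tilde e_iM=A_i(n_e)M$ if $\varepsilon_i(M)>0$ and $\tilde e_iM=0$ otherwise. The crystal graph on $\mathcal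 M$ has an arrow $M\to N$ whenever $\tilde f_iM=N$ for some $i$; connected components are those of the underlying undirected graph. Let $I=\{1\prec 2\prec 3\prec 0\prec\overline 3\prec\overline 2\prec\overline 1\}$, let $\mathrm{dist}(a,b)$ be the number of steps between $a$ and $b$ in this list, and for $k\in\mathbb Z$ let $$X_1(k)=Y_1(k),\quad X_2(k)=Y_1(k+1)^{-1}Y_2(k),\quad X_3(k)=Y_1(k+1)^2Y_2(k+1)^{-1},\quad X_0(k)=Y_1(k+1)Y_1(k+2)^{-1},$$ $$X_{\overline 3}(k)=Y_1(k+2)^{-2}Y_2(k+1),\quad X_{\overline 2}(k)=Y_1(k+2)Y_2(k+2)^{-1},\quad X_{\overline 1}(k)=Y_1(k+3)^{-1}.$$ **Theorem.** Let $m,n\ge 0$ be integers and $\lambda=m\Lambda_1+n\Lambda_2$. The monomial $$M_0=Y_1(-1)^mY_2(-2)^n=X_1(-1)^m\,(X_1(-1)X_2(-2))^n$$ has weight $\lambda$ and satisfies $\tilde e_1M_0=\tilde e_2M_0=0$, and the connected component $\mathcal M'(\lambda)$ of $\mathcal M$ containing $M_0$ is the set of all monomials $$X_{a_1}(-1)\cdots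 X_{a_{m+n}}(-1)\,X_{b_1}(-2)\cdots X_{b_n}(-2)$$ with $a_j,b_j\in I$, $a_1\preceq\cdots\preceq a_{m+n}$, $b_1\preceq\cdots\preceq b_n$, satisfying the following conditions: (i) $0$ occurs at most once among $a_1,\dots,a_{m+n}$ and at most once among $b_1,\dots,b_n$; (ii) for $j=1,\dots,n$: $a_j\prec b_j$ unless $a_j=b_j=0$; (iii) for $j=1,\dots,n$: $\mathrm{dist}(a_j,b_j)\le 2$ if $a_j\in\{1,0\}$, and $\mathrm{dist}(a_j,b_j)\le 3$ otherwise; (iv) for $j=1,\dots,n-1$: $\mathrm{dist}(a_j,b_{j+1})\ge 3$ if $a_j\in\{2,3,0\}$, and $\mathrm{dist}(a_j,b_{j+1})\ge 2$ if $a_j=\overline 3$. -/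

import Mathlib

namespace G2Crystal

/-- The index set `{1, 2}` of the Dynkin diagram of type `G₂`. -/
inductive Node
  | one
  | two
  deriving DecidableEq

/-- The weight lattice `P = ℤΛ₁ ⊕ ℤΛ₂`, a weight being given by its coefficients. -/
abbrev Weight := Node → ℤ

/-- The fundamental weight `Λᵢ`. -/
def fundamentalWeight (i : Node) : Weight := Pi.single i 1

/-- Monomials `∏ Yᵢ(n)^{y_{i,n}}` in the commuting variables `Yᵢ(n)`, `i = 1, 2`, `n ∈ ℤ`, with
integer exponents, i.e. the free abelian group on the `Yᵢ(n)`, written multiplicatively. -/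
abbrev Monomial := Multiplicative ((Node × ℤ) →₀ ℤ)

/-- The exponent of `Yᵢ(n)` in the monomial `M`. -/
def expo (M : Monomial) (i : Node) (n : ℤ) : ℤ := M.toAdd (i, n)

/-- The finite set of all `n` such that `Y₁(n)` or `Y₂(n)` occurs in `M`. -/
def places (M : Monomial) : Finset ℤ := M.toAdd.support.image Prod.snd

/-- The variable `Yᵢ(n)`. -/
noncomputable def Y (i : Node) (n : ℤ) : Monomial :=
  Multiplicative.ofAdd (Finsupp.single (i, n) 1)

/-- The weight `wt(M) = ∑ᵢ (∑ₙ y_{i,n}) Λᵢ`. -/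
def wt (M : Monomial) : Weight := fun i => ∑ k ∈ places M, expo M i k

/-- The partial sum `∑_{k ≤ n} y_{i,k}`. -/
def lowerSum (i : Node) (M : Monomial) (n : ℤ) : ℤ := ∑ k ∈ places M with k ≤ n, expo M i k

/-- The partial sum `∑_{k > n} y_{i,k}`. -/
def upperSum (i : Node) (M : Monomial) (n : ℤ) : ℤ := ∑ k ∈ places M with n < k, expo M i k

/-- `φᵢ(M) = max {∑_{k ≤ n} y_{i,k} | n ∈ ℤ}`. The maximum exists (`isGreatest_phi`), and it is
nonnegative because the partial sums vanish for small `n`. -/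
noncomputable def phi (i : Node) (M : Monomial) : ℤ := ⨆ n : ℤ, lowerSum i M n

/-- `εᵢ(M) = max {-∑_{k > n} y_{i,k} | n ∈ ℤ}`. The maximum exists (`isGreatest_eps`), and it is
nonnegative because the partial sums vanish for large `n`. -/
noncomputable def eps (i : Node) (M : Monomial) : ℤ := ⨆ n : ℤ, -upperSum i M n

/-- `n_f`: the smallest `n` with `φᵢ(M) = ∑_{k ≤ n} y_{i,k}`; it exists if `φᵢ(M) > 0`
(`isLeast_placeF`). -/
noncomputable def placeF (i : Node) (M : Monomial) : ℤ := sInf {n : ℤ | phi i M = lowerSum i M n}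

/-- `n_e`: the largest `n` with `φᵢ(M) = ∑_{k ≤ n} y_{i,k}`; it exists if `εᵢ(M) > 0`
(`isGreatest_placeE`). -/
noncomputable def placeE (i : Node) (M : Monomial) : ℤ := sSup {n : ℤ | phi i M = lowerSum i M n}

/-- `A₁(n) = Y₁(n) Y₁(n+1) Y₂(n)⁻¹` and `A₂(n) = Y₂(n) Y₂(n+1) Y₁(n+1)⁻³`
(the choice `c₁₂ = 1`, `c₂₁ = 0`). -/
noncomputable def A : Node → ℤ → Monomial
  | .one, n => Y .one n * Y .one (n + 1) * (Y .two n)⁻¹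
  | .two, n => Y .two n * Y .two (n + 1) * (Y .one (n + 1) ^ 3)⁻¹

/-- The Kashiwara operator `f̃ᵢ`; the value `none` stands for `0`. -/
noncomputable def fTilde (i : Node) (M : Monomial) : Option Monomial :=
  if phi i M = 0 then none else some ((A i (placeF i M))⁻¹ * M)

/-- The Kashiwara operator `ẽᵢ`; the value `none` stands for `0`. -/
noncomputable def eTilde (i : Node) (M : Monomial) : Option Monomial :=
  if eps i M = 0 then none else some (A i (placeE i M) * M)

/-- There is an arrow from `M` to `N` in the crystal graph: `f̃ᵢ M = N` for some `i`. -/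
def Arrow (M N : Monomial) : Prop := ∃ i : Node, fTilde i M = some N

/-- The connected component of the crystal graph on all monomials that contains `M`
(arrows may be traversed in both directions). -/
def component (M : Monomial) : Set Monomial := {N | Relation.EqvGen Arrow M N}

/-- The set `I = {1, 2, 3, 0, 3̄, 2̄, 1̄}`. -/
inductive Letter
  | one
  | two
  | three
  | zero
  | bar3
  | bar2
  | bar1
  deriving DecidableEq

namespace Letter

/-- The position in the list `1, 2, 3, 0, 3̄, 2̄, 1̄`. -/
def pos : Letter → ℕ
  | one => 0
  | two => 1
  | three => 2
  | zero => 3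
  | bar3 => 4
  | bar2 => 5
  | bar1 => 6

theorem pos_injective : Function.Injective pos := by
  intro a b h
  cases a <;> cases b <;> first | rfl | exact absurd h (by decide)

/-- The linear order `1 ≺ 2 ≺ 3 ≺ 0 ≺ 3̄ ≺ 2̄ ≺ 1̄`. -/
instance : LinearOrder Letter := LinearOrder.lift' pos pos_injective

/-- The distance on `I`: `dist(i,j) = dist(j̄,ī) = j-i` for `i < j`, `dist(i,0) = dist(0,ī) = 4-i`
and `dist(i,j̄) = 8-(i+j)` for `i, j ∈ {1,2,3}`, with `dist(a,b) = dist(b,a)` and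
`dist(a,a) = 0`. -/
def dist : Letter → Letter → ℕ
  | one, two => 1
  | one, three => 2
  | two, three => 1
  | bar2, bar1 => 1
  | bar3, bar1 => 2
  | bar3, bar2 => 1
  | one, zero => 3
  | two, zero => 2
  | three, zero => 1
  | zero, bar1 => 3
  | zero, bar2 => 2
  | zero, bar3 => 1
  | one, bar1 => 6
  | one, bar2 => 5
  | one, bar3 => 4
  | two, bar1 => 5
  | two, bar2 => 4
  | two, bar3 => 3
  | three, bar1 => 4
  | three, bar2 => 3
  | three, bar3 => 2
  | two, one => 1
  | three, one => 2
  | three, two => 1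
  | bar1, bar2 => 1
  | bar1, bar3 => 2
  | bar2, bar3 => 1
  | zero, one => 3
  | zero, two => 2
  | zero, three => 1
  | bar1, zero => 3
  | bar2, zero => 2
  | bar3, zero => 1
  | bar1, one => 6
  | bar2, one => 5
  | bar3, one => 4
  | bar1, two => 5
  | bar2, two => 4
  | bar3, two => 3
  | bar1, three => 4
  | bar2, three => 3
  | bar3, three => 2
  | one, one => 0
  | two, two => 0
  | three, three => 0
  | zero, zero => 0
  | bar3, bar3 => 0
  | bar2, bar2 => 0
  | bar1, bar1 => 0

theorem dist_eq (a b : Letter) : dist a b = Nat.dist (pos a) (pos b) := by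
  cases a <;> cases b <;> rfl

end Letter

/-- The monomials `X_a(m)`, `a ∈ I`, `m ∈ ℤ`. -/
noncomputable def X : Letter → ℤ → Monomial
  | .one, m => Y .one m
  | .two, m => (Y .one (m + 1))⁻¹ * Y .two m
  | .three, m => Y .one (m + 1) ^ 2 * (Y .two (m + 1))⁻¹
  | .zero, m => Y .one (m + 1) * (Y .one (m + 2))⁻¹
  | .bar3, m => (Y .one (m + 2) ^ 2)⁻¹ * Y .two (m + 1)
  | .bar2, m => Y .one (m + 2) * (Y .two (m + 2))⁻¹
  | .bar1, m => (Y .one (m + 3))⁻¹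

/-- The conditions on the indices `a₁, …, a_{m+n}` and `b₁, …, b_n` (numbered from `0` here). -/
structure Admissible {m n : ℕ} (a : Fin (m + n) → Letter) (b : Fin n → Letter) : Prop where
  /-- `a₁ ≼ ⋯ ≼ a_{m+n}` -/
  mono_a : Monotone a
  /-- `b₁ ≼ ⋯ ≼ b_n` -/
  mono_b : Monotone b
  /-- (i) for the `a`'s: the entry `0` is not repeated -/
  zero_a : ∀ j k, a j = .zero → a k = .zero → j = k
  /-- (i) for the `b`'s: the entry `0` is not repeated -/
  zero_b : ∀ j k, b j = .zero → b k = .zero → j = k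
  /-- (ii) `a_j ≺ b_j` unless `a_j = b_j = 0`, for `1 ≤ j ≤ n` -/
  column : ∀ j : Fin n, ¬ (a (j.castLE (Nat.le_add_left n m)) = .zero ∧ b j = .zero) →
    a (j.castLE (Nat.le_add_left n m)) < b j
  /-- (iii) for `a_j ∈ {1, 0}` -/
  dist_le_two : ∀ j : Fin n,
    (a (j.castLE (Nat.le_add_left n m)) = .one ∨ a (j.castLE (Nat.le_add_left n m)) = .zero) →
    Letter.dist (a (j.castLE (Nat.le_add_left n m))) (b j) ≤ 2
  /-- (iii) for all other values of `a_j` -/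
  dist_le_three : ∀ j : Fin n,
    ¬ (a (j.castLE (Nat.le_add_left n m)) = .one ∨ a (j.castLE (Nat.le_add_left n m)) = .zero) →
    Letter.dist (a (j.castLE (Nat.le_add_left n m))) (b j) ≤ 3
  /-- (iv) for `a_j ∈ {2, 3, 0}`, `k = j + 1` -/
  three_le_dist : ∀ j k : Fin n, (j : ℕ) + 1 = k →
    (a (j.castLE (Nat.le_add_left n m)) = .two ∨ a (j.castLE (Nat.le_add_left n m)) = .three ∨
      a (j.castLE (Nat.le_add_left n m)) = .zero) →
    3 ≤ Letter.dist (a (j.castLE (Nat.le_add_left n m))) (b k)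
  /-- (iv) for `a_j = 3̄`, `k = j + 1` -/
  two_le_dist : ∀ j k : Fin n, (j : ℕ) + 1 = k →
    a (j.castLE (Nat.le_add_left n m)) = .bar3 →
    2 ≤ Letter.dist (a (j.castLE (Nat.le_add_left n m))) (b k)

/-! The maxima and minima in the definitions above exist. -/

theorem exists_bounds (M : Monomial) : ∃ L U : ℤ, ∀ k ∈ places M, L < k ∧ k ≤ U := by
  obtain ⟨U, hU⟩ := (places M).bddAbove
  obtain ⟨L, hL⟩ := (places M).bddBelow
  exact ⟨L - 1, U, fun k hk => ⟨by have := hL hk; lia, hU hk⟩⟩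

theorem lowerSum_add_upperSum (i : Node) (M : Monomial) (n : ℤ) :
    lowerSum i M n + upperSum i M n = wt M i := by
  have h := Finset.sum_filter_add_sum_filter_not (places M) (fun k => k ≤ n) (expo M i)
  simp only [not_le] at h
  exact h

theorem finite_range_lowerSum (i : Node) (M : Monomial) :
    (Set.range (lowerSum i M)).Finite := by
  refine Set.Finite.subset
    ((places M).powerset.image fun s => ∑ k ∈ s, expo M i k).finite_toSet ?_
  rintro _ ⟨n, rfl⟩
  exact Finset.mem_coe.2 (Finset.mem_image_of_mem _
    (Finset.mem_powerset.2 (Finset.filter_subset _ _)))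

theorem isGreatest_phi (i : Node) (M : Monomial) :
    IsGreatest (Set.range (lowerSum i M)) (phi i M) :=
  ⟨Int.csSup_mem (Set.range_nonempty _) (finite_range_lowerSum i M).bddAbove,
    fun _ h => le_csSup (finite_range_lowerSum i M).bddAbove h⟩

theorem isGreatest_eps (i : Node) (M : Monomial) :
    IsGreatest (Set.range fun n => -upperSum i M n) (eps i M) := by
  have hfin : (Set.range fun n => -upperSum i M n).Finite := by
    refine Set.Finite.subset ((finite_range_lowerSum i M).image fun x => x - wt M i) ?_
    rintro _ ⟨n, rfl⟩
    refine ⟨lowerSum i M n, ⟨n, rfl⟩, ?_⟩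
    have := lowerSum_add_upperSum i M n
    show lowerSum i M n - wt M i = -upperSum i M n
    lia
  exact ⟨Int.csSup_mem (Set.range_nonempty _) hfin.bddAbove,
    fun _ h => le_csSup hfin.bddAbove h⟩

/-- The relation `⟨hᵢ, wt(M)⟩ = φᵢ(M) - εᵢ(M)`. -/
theorem phi_sub_eps (i : Node) (M : Monomial) : phi i M - eps i M = wt M i := by
  obtain ⟨⟨n, hn⟩, hmax⟩ := isGreatest_phi i M
  obtain ⟨⟨k, hk⟩, hmax'⟩ := isGreatest_eps i M
  have h1 := lowerSum_add_upperSum i M n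
  have h2 := lowerSum_add_upperSum i M k
  have h3 := hmax ⟨k, rfl⟩
  have h4 := hmax' ⟨n, rfl⟩
  dsimp only at hk h4
  lia

theorem isLeast_placeF (i : Node) (M : Monomial) (h : 0 < phi i M) :
    IsLeast {n : ℤ | phi i M = lowerSum i M n} (placeF i M) := by
  obtain ⟨L, U, hb⟩ := exists_bounds M
  have hbdd : BddBelow {n : ℤ | phi i M = lowerSum i M n} := by
    refine ⟨L, fun n hn => ?_⟩
    by_contra hlt
    have hz : lowerSum i M n = 0 := by
      unfold lowerSum
      rw [Finset.filter_false_of_mem, Finset.sum_empty]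
      intro k hk
      have := (hb k hk).1
      lia
    have hn' : phi i M = lowerSum i M n := hn
    lia
  obtain ⟨⟨n, hn⟩, -⟩ := isGreatest_phi i M
  exact ⟨Int.csInf_mem ⟨n, hn.symm⟩ hbdd, fun _ hk => csInf_le hbdd hk⟩

theorem isGreatest_placeE (i : Node) (M : Monomial) (h : 0 < eps i M) :
    IsGreatest {n : ℤ | phi i M = lowerSum i M n} (placeE i M) := by
  obtain ⟨L, U, hb⟩ := exists_bounds M
  have hbdd : BddAbove {n : ℤ | phi i M = lowerSum i M n} := by
    refine ⟨U, fun n hn => ?_⟩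
    by_contra hlt
    have hz : upperSum i M n = 0 := by
      unfold upperSum
      rw [Finset.filter_false_of_mem, Finset.sum_empty]
      intro k hk
      have := (hb k hk).2
      lia
    have hn' : phi i M = lowerSum i M n := hn
    have h1 := lowerSum_add_upperSum i M n
    have h2 := phi_sub_eps i M
    lia
  obtain ⟨⟨n, hn⟩, -⟩ := isGreatest_phi i M
  exact ⟨Int.csSup_mem ⟨n, hn.symm⟩ hbdd, fun _ hk => le_csSup hbdd hk⟩

end G2Crystal

open G2Crystal

namespace G2Crystal

/-! ### Exponents and partial sums are additive -/

/-! Both sides of the claimed equality are identified with one explicit set, `polytope m n`: the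
quotients of the top monomial by powers of `A₂(-2)`, `A₁(-1)`, `A₂(-1)`, `A₁(0)`, `A₂(0)`, `A₁(1)`
whose exponents satisfy a short list of linear inequalities.

The component equals the polytope (`component_eq_polytope`). The inequalities are preserved by `f̃ᵢ`
and by `ẽᵢ`, and these operators invert each other, so the component stays inside. Conversely, the
top monomial is the only one in the polytope killed by both `ẽᵢ`, and each `ẽᵢ` lowers the total
exponent by one; hence every point climbs to the top in finitely many steps.

The tableau monomials equal the polytope (`polytope_eq_setOf_admissible`). Moving a letter one step
to the right divides `X` by a fixed `Aᵢ`, so the monomial of a tableau depends only on the numbers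
of entries `≽ x` in each row, and its exponents are sums of these numbers. Admissibility becomes a
system of inequalities between the counts (`admissible_iff`). These imply the polytope inequalities,
and every point of the polytope splits into admissible counts (`InPolytope.exists_counts`). -/

@[simp] theorem expo_one (i : Node) (k : ℤ) : expo 1 i k = 0 := rfl

@[simp] theorem expo_mul (M N : Monomial) (i : Node) (k : ℤ) :
    expo (M * N) i k = expo M i k + expo N i k := rfl

@[simp] theorem expo_inv (M : Monomial) (i : Node) (k : ℤ) : expo M⁻¹ i k = -expo M i k := rfl

@[simp] theorem expo_zpow (M : Monomial) (r : ℤ) (i : Node) (k : ℤ) :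
    expo (M ^ r) i k = r * expo M i k := by
  simp [expo]

@[simp] theorem expo_pow (M : Monomial) (r : ℕ) (i : Node) (k : ℤ) :
    expo (M ^ r) i k = r * expo M i k := by
  simp [expo]

theorem expo_Y (i j : Node) (k l : ℤ) : expo (Y j l) i k = if j = i ∧ l = k then 1 else 0 := by
  simp [expo, Y, Finsupp.single_apply]

theorem monomial_ext {M N : Monomial} (h : ∀ i k, expo M i k = expo N i k) : M = N := by
  apply Multiplicative.toAdd.injective
  ext ⟨i, k⟩
  exact h i k

theorem expo_eq_zero_of_notMem {M : Monomial} {k : ℤ} (h : k ∉ places M) (i : Node) :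
    expo M i k = 0 := by
  by_contra h0
  exact h (Finset.mem_image.2 ⟨(i, k), Finsupp.mem_support_iff.2 h0, rfl⟩)

/-- Exponents vanish off `places M`. Passing to a larger set lets the sums of several monomials run
over a common index set, which gives additivity. -/
theorem lowerSum_eq_sum {M : Monomial} {s : Finset ℤ} (h : places M ⊆ s) (i : Node) (n : ℤ) :
    lowerSum i M n = ∑ k ∈ s with k ≤ n, expo M i k := by
  refine Finset.sum_subset (Finset.filter_subset_filter _ h) fun k hk hk' => ?_
  refine expo_eq_zero_of_notMem (fun hp => hk' ?_) i
  exact Finset.mem_filter.2 ⟨hp, (Finset.mem_filter.1 hk).2⟩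

theorem wt_eq_sum {M : Monomial} {s : Finset ℤ} (h : places M ⊆ s) (i : Node) :
    wt M i = ∑ k ∈ s, expo M i k :=
  Finset.sum_subset h fun _ _ hk' => expo_eq_zero_of_notMem hk' i

theorem exists_common_places (M N : Monomial) :
    ∃ s, places M ⊆ s ∧ places N ⊆ s ∧ places (M * N) ⊆ s :=
  ⟨places M ∪ places N ∪ places (M * N), by grind, by grind, by grind⟩

@[simp] theorem lowerSum_mul (i : Node) (M N : Monomial) (n : ℤ) :
    lowerSum i (M * N) n = lowerSum i M n + lowerSum i N n := by
  obtain ⟨s, h1, h2, h3⟩ := exists_common_places M N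
  rw [lowerSum_eq_sum h1, lowerSum_eq_sum h2, lowerSum_eq_sum h3, ← Finset.sum_add_distrib]
  rfl

@[simp] theorem wt_mul (M N : Monomial) (i : Node) : wt (M * N) i = wt M i + wt N i := by
  obtain ⟨s, h1, h2, h3⟩ := exists_common_places M N
  rw [wt_eq_sum h1, wt_eq_sum h2, wt_eq_sum h3, ← Finset.sum_add_distrib]
  rfl

/-- The partial sum up to `n` as a homomorphism. -/
noncomputable def lowerSumHom (i : Node) (n : ℤ) : Monomial →* Multiplicative ℤ :=
  MonoidHom.mk' (fun M => Multiplicative.ofAdd (lowerSum i M n)) fun M N => by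
    rw [lowerSum_mul, ofAdd_add]

/-- The coefficient of `Λᵢ` in the weight as a homomorphism. -/
noncomputable def wtHom (i : Node) : Monomial →* Multiplicative ℤ :=
  MonoidHom.mk' (fun M => Multiplicative.ofAdd (wt M i)) fun M N => by
    rw [wt_mul, ofAdd_add]

@[simp] theorem lowerSum_inv (i : Node) (M : Monomial) (n : ℤ) :
    lowerSum i M⁻¹ n = -lowerSum i M n :=
  congrArg Multiplicative.toAdd (map_inv (lowerSumHom i n) M)

@[simp] theorem lowerSum_zpow (i : Node) (M : Monomial) (r n : ℤ) :
    lowerSum i (M ^ r) n = r * lowerSum i M n :=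
  (congrArg Multiplicative.toAdd (map_zpow (lowerSumHom i n) M r)).trans (by simp [lowerSumHom])

@[simp] theorem lowerSum_pow (i : Node) (M : Monomial) (r : ℕ) (n : ℤ) :
    lowerSum i (M ^ r) n = r * lowerSum i M n :=
  (congrArg Multiplicative.toAdd (map_pow (lowerSumHom i n) M r)).trans (by simp [lowerSumHom])

@[simp] theorem wt_inv (M : Monomial) (i : Node) : wt M⁻¹ i = -wt M i :=
  congrArg Multiplicative.toAdd (map_inv (wtHom i) M)

@[simp] theorem wt_zpow (M : Monomial) (r : ℤ) (i : Node) : wt (M ^ r) i = r * wt M i :=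
  (congrArg Multiplicative.toAdd (map_zpow (wtHom i) M r)).trans (by simp [wtHom])

@[simp] theorem wt_pow (M : Monomial) (r : ℕ) (i : Node) : wt (M ^ r) i = r * wt M i :=
  (congrArg Multiplicative.toAdd (map_pow (wtHom i) M r)).trans (by simp [wtHom])

theorem places_Y (j : Node) (l : ℤ) : places (Y j l) ⊆ {l} := by
  intro k hk
  obtain ⟨⟨i, k'⟩, h, rfl⟩ := Finset.mem_image.1 hk
  have h' := Finsupp.support_single_subset h
  simp only [Finset.mem_singleton, Prod.mk.injEq] at h'
  simp [h'.2]

theorem lowerSum_Y (i j : Node) (l n : ℤ) :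
    lowerSum i (Y j l) n = if j = i ∧ l ≤ n then 1 else 0 := by
  rw [lowerSum_eq_sum (places_Y j l), Finset.sum_filter, Finset.sum_singleton, expo_Y]
  grind

theorem wt_Y (i j : Node) (l : ℤ) : wt (Y j l) i = if j = i then 1 else 0 := by
  rw [wt_eq_sum (places_Y j l), Finset.sum_singleton, expo_Y]
  grind

theorem lowerSum_A_self (i : Node) (k n : ℤ) :
    lowerSum i (A i k) n = (if k ≤ n then 1 else 0) + if k + 1 ≤ n then 1 else 0 := by
  cases i <;> simp [A, lowerSum_Y]

theorem wt_A_self (i : Node) (k : ℤ) : wt (A i k) i = 2 := by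
  cases i <;> simp [A, wt_Y]

/-! ### The operators `f̃ᵢ` and `ẽᵢ` are inverse to each other -/

theorem lowerSum_le_phi (i : Node) (M : Monomial) (n : ℤ) : lowerSum i M n ≤ phi i M :=
  (isGreatest_phi i M).2 ⟨n, rfl⟩

theorem neg_upperSum_le_eps (i : Node) (M : Monomial) (n : ℤ) : -upperSum i M n ≤ eps i M :=
  (isGreatest_eps i M).2 ⟨n, rfl⟩

theorem phi_nonneg (i : Node) (M : Monomial) : 0 ≤ phi i M := by
  obtain ⟨L, U, hb⟩ := exists_bounds M
  have hz : lowerSum i M L = 0 := by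
    unfold lowerSum
    rw [Finset.filter_false_of_mem, Finset.sum_empty]
    intro k hk
    have := (hb k hk).1
    lia
  exact hz ▸ lowerSum_le_phi i M L

theorem eps_nonneg (i : Node) (M : Monomial) : 0 ≤ eps i M := by
  obtain ⟨L, U, hb⟩ := exists_bounds M
  have hz : upperSum i M U = 0 := by
    unfold upperSum
    rw [Finset.filter_false_of_mem, Finset.sum_empty]
    intro k hk
    have := (hb k hk).2
    lia
  simpa [hz] using neg_upperSum_le_eps i M U

theorem phi_eq_of_isGreatest {i : Node} {M : Monomial} {n : ℤ}
    (h : ∀ k, lowerSum i M k ≤ lowerSum i M n) : phi i M = lowerSum i M n :=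
  (isGreatest_phi i M).unique ⟨⟨n, rfl⟩, by rintro _ ⟨k, rfl⟩; exact h k⟩

/-- `f̃ᵢ M = N` read off from the partial sums. -/
theorem fTilde_eq_some_iff (i : Node) (M N : Monomial) :
    fTilde i M = some N ↔ ∃ k, 0 < lowerSum i M k ∧ (∀ l, lowerSum i M l ≤ lowerSum i M k) ∧
      (∀ l < k, lowerSum i M l < lowerSum i M k) ∧ N = (A i k)⁻¹ * M := by
  unfold fTilde
  constructor
  · intro h
    split_ifs at h with h0
    have hpos : 0 < phi i M := lt_of_le_of_ne (phi_nonneg i M) (Ne.symm h0)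
    obtain ⟨hk, hl⟩ := isLeast_placeF i M hpos
    simp only [Set.mem_ofPred_eq] at hk
    refine ⟨placeF i M, hk ▸ hpos, fun l => hk ▸ lowerSum_le_phi i M l, fun l hlt => ?_,
      (Option.some.inj h).symm⟩
    refine hk ▸ lt_of_le_of_ne (lowerSum_le_phi i M l) fun heq => ?_
    exact absurd (hl heq.symm) (not_le.2 hlt)
  · rintro ⟨k, hpos, hmax, hlt, rfl⟩
    have hphi := phi_eq_of_isGreatest hmax
    rw [if_neg (by lia)]
    obtain ⟨hk, hl⟩ := isLeast_placeF i M (by lia)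
    have h1 := hl hphi
    simp only [Set.mem_ofPred_eq] at hk
    have h2 : ¬ placeF i M < k := fun h => by
      have := hlt _ h
      lia
    rw [le_antisymm h1 (not_lt.1 h2)]

/-- `ẽᵢ M = N` read off from the partial sums. -/
theorem eTilde_eq_some_iff (i : Node) (M N : Monomial) :
    eTilde i M = some N ↔ ∃ k, wt M i < lowerSum i M k ∧
      (∀ l, lowerSum i M l ≤ lowerSum i M k) ∧
      (∀ l, k < l → lowerSum i M l < lowerSum i M k) ∧ N = A i k * M := by
  have hpe := phi_sub_eps i M
  unfold eTilde
  constructor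
  · intro h
    split_ifs at h with h0
    have hpos : 0 < eps i M := lt_of_le_of_ne (eps_nonneg i M) (Ne.symm h0)
    obtain ⟨hk, hl⟩ := isGreatest_placeE i M hpos
    simp only [Set.mem_ofPred_eq] at hk
    refine ⟨placeE i M, by lia, fun l => hk ▸ lowerSum_le_phi i M l, fun l hlt => ?_,
      (Option.some.inj h).symm⟩
    refine hk ▸ lt_of_le_of_ne (lowerSum_le_phi i M l) fun heq => ?_
    exact absurd (hl heq.symm) (not_le.2 hlt)
  · rintro ⟨k, hpos, hmax, hlt, rfl⟩
    have hphi := phi_eq_of_isGreatest hmax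
    rw [if_neg (by lia)]
    obtain ⟨hk, hl⟩ := isGreatest_placeE i M (by lia)
    have h1 := hl hphi
    simp only [Set.mem_ofPred_eq] at hk
    have h2 : ¬ k < placeE i M := fun h => by
      have := hlt _ h
      lia
    rw [le_antisymm h1 (not_lt.1 h2)]

theorem exists_lowerSum_eq_wt (i : Node) (M : Monomial) (k : ℤ) :
    ∃ l, k < l ∧ lowerSum i M l = wt M i := by
  obtain ⟨L, U, hb⟩ := exists_bounds M
  refine ⟨max (k + 1) U, by lia, ?_⟩
  unfold lowerSum
  rw [Finset.filter_true_of_mem]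
  · rfl
  · intro l hl
    have := (hb l hl).2
    lia

theorem exists_lowerSum_eq_zero (i : Node) (M : Monomial) (k : ℤ) :
    ∃ l < k, lowerSum i M l = 0 := by
  obtain ⟨L, U, hb⟩ := exists_bounds M
  refine ⟨min (k - 1) L, by lia, ?_⟩
  unfold lowerSum
  rw [Finset.filter_false_of_mem, Finset.sum_empty]
  intro l hl
  have := (hb l hl).1
  lia

/-- `Aᵢ(k)` adds 1 to the partial sum at `k` and 2 to all later ones. Dividing by it at the first
maximum therefore makes `k` the last maximum, one lower; multiplying at the last maximum reverses
this. -/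
theorem fTilde_eq_some_iff_eTilde (i : Node) (M N : Monomial) :
    fTilde i M = some N ↔ eTilde i N = some M := by
  rw [fTilde_eq_some_iff, eTilde_eq_some_iff]
  constructor
  · rintro ⟨k, -, hmax, hlt, rfl⟩
    have key (l : ℤ) := lowerSum_A_self i k l
    have hk := key k
    refine ⟨k, ?_, fun l => ?_, fun l hl => ?_, by simp⟩
    · obtain ⟨l, hl, hw⟩ := exists_lowerSum_eq_wt i M k
      have := hmax l
      simp only [wt_mul, wt_inv, lowerSum_mul, lowerSum_inv, wt_A_self]
      grind
    · have h1 := key l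
      have h2 := hmax l
      have h3 := hlt l
      simp only [lowerSum_mul, lowerSum_inv]
      grind
    · have h1 := key l
      have h2 := hmax l
      simp only [lowerSum_mul, lowerSum_inv]
      grind
  · rintro ⟨k, -, hmax, hlt, rfl⟩
    have key (l : ℤ) := lowerSum_A_self i k l
    have hk := key k
    refine ⟨k, ?_, fun l => ?_, fun l hl => ?_, by simp⟩
    · obtain ⟨l, hl, hw⟩ := exists_lowerSum_eq_zero i N k
      have := hmax l
      simp only [lowerSum_mul]
      grind
    · have h1 := key l
      have h2 := hmax l
      have h3 := hlt l
      simp only [lowerSum_mul]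
      grind
    · have h1 := key l
      have h2 := hmax l
      simp only [lowerSum_mul]
      grind

/-! ### The component in terms of the exponents of the `Aᵢ(k)` -/

/-- The monomial obtained from `Y₁(-1)ᵐ Y₂(-2)ⁿ` by dividing by powers of `A₂(-2)`, `A₁(-1)`,
`A₂(-1)`, `A₁(0)`, `A₂(0)`, `A₁(1)`, in this order. -/
noncomputable def descend (m n : ℕ) (z₁ x₁ z₂ x₂ z₃ x₃ : ℤ) : Monomial :=
  Y .one (-1) ^ m * Y .two (-2) ^ n * A .two (-2) ^ (-z₁) * A .one (-1) ^ (-x₁) *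
    A .two (-1) ^ (-z₂) * A .one 0 ^ (-x₂) * A .two 0 ^ (-z₃) * A .one 1 ^ (-x₃)

/-- The inequalities describing the exponents that occur in the component
(a polyhedral realization of the crystal). -/
structure InPolytope (m n : ℕ) (z₁ x₁ z₂ x₂ z₃ x₃ : ℤ) : Prop where
  z₁_nonneg : 0 ≤ z₁
  z₁_le : z₁ ≤ n
  x₁_le : x₁ ≤ m + 3 * z₁
  z₂_le : z₂ ≤ x₁
  three_z₂_le : 3 * z₂ ≤ 2 * x₁ + m
  x₂_le : x₂ ≤ 2 * z₂
  two_x₂_le : 2 * x₂ ≤ 3 * z₂ + m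
  two_z₃_le : 2 * z₃ ≤ x₂
  three_z₃_le : 3 * z₃ ≤ x₂ + m
  x₃_nonneg : 0 ≤ x₃
  x₃_le : x₃ ≤ z₃
  x₃_le' : x₃ ≤ m

/-- The monomials with exponents in the polytope. -/
def polytope (m n : ℕ) : Set Monomial :=
  {M | ∃ z₁ x₁ z₂ x₂ z₃ x₃ : ℤ, InPolytope m n z₁ x₁ z₂ x₂ z₃ x₃ ∧
    M = descend m n z₁ x₁ z₂ x₂ z₃ x₃}

theorem descend_zero (m n : ℕ) :
    descend m n 0 0 0 0 0 0 = Y .one (-1) ^ m * Y .two (-2) ^ n := by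
  simp [descend]

theorem lowerSum_one_descend (m n : ℕ) (z₁ x₁ z₂ x₂ z₃ x₃ k : ℤ) :
    lowerSum .one (descend m n z₁ x₁ z₂ x₂ z₃ x₃) k =
      (if -1 ≤ k then m - x₁ + 3 * z₁ else 0) + (if 0 ≤ k then -x₁ - x₂ + 3 * z₂ else 0) +
      (if 1 ≤ k then -x₂ - x₃ + 3 * z₃ else 0) + (if 2 ≤ k then -x₃ else 0) := by
  simp only [descend, A, lowerSum_mul, lowerSum_pow, lowerSum_zpow, lowerSum_inv, lowerSum_Y,
    true_and, reduceCtorEq, false_and, if_false]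
  norm_num
  split_ifs <;> ring

theorem lowerSum_two_descend (m n : ℕ) (z₁ x₁ z₂ x₂ z₃ x₃ k : ℤ) :
    lowerSum .two (descend m n z₁ x₁ z₂ x₂ z₃ x₃) k =
      (if -2 ≤ k then n - z₁ else 0) + (if -1 ≤ k then x₁ - z₁ - z₂ else 0) +
      (if 0 ≤ k then x₂ - z₂ - z₃ else 0) + (if 1 ≤ k then x₃ - z₃ else 0) := by
  simp only [descend, A, lowerSum_mul, lowerSum_pow, lowerSum_zpow, lowerSum_inv, lowerSum_Y,
    true_and, reduceCtorEq, false_and, if_false]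
  norm_num
  split_ifs <;> ring

theorem wt_one_descend (m n : ℕ) (z₁ x₁ z₂ x₂ z₃ x₃ : ℤ) :
    wt (descend m n z₁ x₁ z₂ x₂ z₃ x₃) .one =
      m - 2 * (x₁ + x₂ + x₃) + 3 * (z₁ + z₂ + z₃) := by
  simp [descend, A, wt_Y]
  ring

theorem wt_two_descend (m n : ℕ) (z₁ x₁ z₂ x₂ z₃ x₃ : ℤ) :
    wt (descend m n z₁ x₁ z₂ x₂ z₃ x₃) .two =
      n - 2 * (z₁ + z₂ + z₃) + (x₁ + x₂ + x₃) := by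
  simp [descend, A, wt_Y]
  ring

/-! ### Stability of the polytope under the Kashiwara operators -/

/-- At the first maximum the jump is positive. This bounds the raised exponent by the two preceding
it, and the inequalities between those two turn this into the required upper bounds; the lower
bounds only relax. -/
theorem fTilde_mem_polytope {m n : ℕ} {M N : Monomial} {i : Node} (hM : M ∈ polytope m n)
    (h : fTilde i M = some N) : N ∈ polytope m n := by
  obtain ⟨z₁, x₁, z₂, x₂, z₃, x₃, hp, rfl⟩ := hM
  obtain ⟨k, hpos, hmax, hlt, rfl⟩ := (fTilde_eq_some_iff _ _ _).1 h
  obtain ⟨_, _, _, _, _, _, _, _, _, _, _, _⟩ := hp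
  cases i
  · simp only [lowerSum_one_descend] at hpos hmax hlt
    -- Sums before `-1` vanish, and the last jump, at 2, is `-x₃ ≤ 0`, so no first positive maximum
    -- lies outside this range.
    have hk : k = -1 ∨ k = 0 ∨ k = 1 := by
      have := hlt 1
      by_contra
      split_ifs at hpos this <;> simp at this <;> lia
    have h1 := hmax (-1)
    have h2 := hmax 0
    have h3 := hmax 1
    rcases hk with rfl | rfl | rfl
    · norm_num at hpos h1 h2 h3
      refine ⟨z₁, x₁ + 1, z₂, x₂, z₃, x₃, ⟨?_, ?_, ?_, ?_, ?_, ?_, ?_, ?_, ?_, ?_, ?_, ?_⟩, ?_⟩ <;>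
      first
      | lia
      | exact monomial_ext fun _ _ => by
          simp only [descend, expo_mul, expo_inv, expo_pow, expo_zpow]; ring
    · have h4 := hlt (-1)
      norm_num at hpos h1 h2 h3 h4
      refine ⟨z₁, x₁, z₂, x₂ + 1, z₃, x₃, ⟨?_, ?_, ?_, ?_, ?_, ?_, ?_, ?_, ?_, ?_, ?_, ?_⟩, ?_⟩ <;>
      first
      | lia
      | exact monomial_ext fun _ _ => by
          simp only [descend, expo_mul, expo_inv, expo_pow, expo_zpow]; ring
    · have h4 := hlt (-1)
      have h5 := hlt 0
      norm_num at hpos h1 h2 h3 h4 h5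
      refine ⟨z₁, x₁, z₂, x₂, z₃, x₃ + 1, ⟨?_, ?_, ?_, ?_, ?_, ?_, ?_, ?_, ?_, ?_, ?_, ?_⟩, ?_⟩ <;>
      first
      | lia
      | exact monomial_ext fun _ _ => by
          simp only [descend, expo_mul, expo_inv, expo_pow, expo_zpow]; ring
  · simp only [lowerSum_two_descend] at hpos hmax hlt
    have hk : k = -2 ∨ k = -1 ∨ k = 0 := by
      have := hlt 0
      by_contra
      split_ifs at hpos this <;> simp at this <;> lia
    have h1 := hmax (-2)
    have h2 := hmax (-1)
    have h3 := hmax 0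
    rcases hk with rfl | rfl | rfl
    · norm_num at hpos h1 h2 h3
      refine ⟨z₁ + 1, x₁, z₂, x₂, z₃, x₃, ⟨?_, ?_, ?_, ?_, ?_, ?_, ?_, ?_, ?_, ?_, ?_, ?_⟩, ?_⟩ <;>
      first
      | lia
      | exact monomial_ext fun _ _ => by
          simp only [descend, expo_mul, expo_inv, expo_pow, expo_zpow]; ring
    · have h4 := hlt (-2)
      norm_num at hpos h1 h2 h3 h4
      refine ⟨z₁, x₁, z₂ + 1, x₂, z₃, x₃, ⟨?_, ?_, ?_, ?_, ?_, ?_, ?_, ?_, ?_, ?_, ?_, ?_⟩, ?_⟩ <;>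
      first
      | lia
      | exact monomial_ext fun _ _ => by
          simp only [descend, expo_mul, expo_inv, expo_pow, expo_zpow]; ring
    · have h4 := hlt (-2)
      have h5 := hlt (-1)
      norm_num at hpos h1 h2 h3 h4 h5
      refine ⟨z₁, x₁, z₂, x₂, z₃ + 1, x₃, ⟨?_, ?_, ?_, ?_, ?_, ?_, ?_, ?_, ?_, ?_, ?_, ?_⟩, ?_⟩ <;>
      first
      | lia
      | exact monomial_ext fun _ _ => by
          simp only [descend, expo_mul, expo_inv, expo_pow, expo_zpow]; ring

/-- Mirror image of the argument for `f̃ᵢ`: the jump after the last maximum is negative, which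
bounds the lowered exponent below by the exponents following it. -/
theorem eTilde_mem_polytope {m n : ℕ} {M N : Monomial} {i : Node} (hM : M ∈ polytope m n)
    (h : eTilde i M = some N) : N ∈ polytope m n := by
  obtain ⟨z₁, x₁, z₂, x₂, z₃, x₃, hp, rfl⟩ := hM
  obtain ⟨k, hpos, hmax, hlt, rfl⟩ := (eTilde_eq_some_iff _ _ _).1 h
  obtain ⟨_, _, _, _, _, _, _, _, _, _, _, _⟩ := hp
  cases i
  · simp only [lowerSum_one_descend, wt_one_descend] at hpos hmax hlt
    -- The sum at `-1` is `m + 3 * z₁ - x₁ ≥ 0`, so the last maximum is not earlier; from 2 on the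
    -- sum equals the weight, which the maximum exceeds.
    have hk : k = -1 ∨ k = 0 ∨ k = 1 := by
      have := hlt (-1)
      have := hmax (-1)
      by_contra
      grind
    have h1 := hmax (-1)
    have h2 := hmax 0
    have h3 := hmax 1
    rcases hk with rfl | rfl | rfl
    · have h4 := hlt 0 (by norm_num)
      have h5 := hlt 1 (by norm_num)
      have h6 := hlt 2 (by norm_num)
      norm_num at hpos h1 h2 h3 h4 h5 h6
      refine ⟨z₁, x₁ - 1, z₂, x₂, z₃, x₃, ⟨?_, ?_, ?_, ?_, ?_, ?_, ?_, ?_, ?_, ?_, ?_, ?_⟩, ?_⟩ <;>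
      first
      | lia
      | exact monomial_ext fun _ _ => by
          simp only [descend, expo_mul, expo_pow, expo_zpow]; ring
    · have h4 := hlt 1 (by norm_num)
      have h5 := hlt 2 (by norm_num)
      norm_num at hpos h1 h2 h3 h4 h5
      refine ⟨z₁, x₁, z₂, x₂ - 1, z₃, x₃, ⟨?_, ?_, ?_, ?_, ?_, ?_, ?_, ?_, ?_, ?_, ?_, ?_⟩, ?_⟩ <;>
      first
      | lia
      | exact monomial_ext fun _ _ => by
          simp only [descend, expo_mul, expo_pow, expo_zpow]; ring
    · have h4 := hlt 2 (by norm_num)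
      norm_num at hpos h1 h2 h3 h4
      refine ⟨z₁, x₁, z₂, x₂, z₃, x₃ - 1, ⟨?_, ?_, ?_, ?_, ?_, ?_, ?_, ?_, ?_, ?_, ?_, ?_⟩, ?_⟩ <;>
      first
      | lia
      | exact monomial_ext fun _ _ => by
          simp only [descend, expo_mul, expo_pow, expo_zpow]; ring
  · simp only [lowerSum_two_descend, wt_two_descend] at hpos hmax hlt
    have hk : k = -2 ∨ k = -1 ∨ k = 0 := by
      have := hlt (-2)
      have := hmax (-2)
      by_contra
      grind
    have h1 := hmax (-2)
    have h2 := hmax (-1)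
    have h3 := hmax 0
    rcases hk with rfl | rfl | rfl
    · have h4 := hlt (-1) (by norm_num)
      have h5 := hlt 0 (by norm_num)
      have h6 := hlt 1 (by norm_num)
      norm_num at hpos h1 h2 h3 h4 h5 h6
      refine ⟨z₁ - 1, x₁, z₂, x₂, z₃, x₃, ⟨?_, ?_, ?_, ?_, ?_, ?_, ?_, ?_, ?_, ?_, ?_, ?_⟩, ?_⟩ <;>
      first
      | lia
      | exact monomial_ext fun _ _ => by
          simp only [descend, expo_mul, expo_pow, expo_zpow]; ring
    · have h4 := hlt 0 (by norm_num)
      have h5 := hlt 1 (by norm_num)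
      norm_num at hpos h1 h2 h3 h4 h5
      refine ⟨z₁, x₁, z₂ - 1, x₂, z₃, x₃, ⟨?_, ?_, ?_, ?_, ?_, ?_, ?_, ?_, ?_, ?_, ?_, ?_⟩, ?_⟩ <;>
      first
      | lia
      | exact monomial_ext fun _ _ => by
          simp only [descend, expo_mul, expo_pow, expo_zpow]; ring
    · have h4 := hlt 1 (by norm_num)
      norm_num at hpos h1 h2 h3 h4
      refine ⟨z₁, x₁, z₂, x₂, z₃ - 1, x₃, ⟨?_, ?_, ?_, ?_, ?_, ?_, ?_, ?_, ?_, ?_, ?_, ?_⟩, ?_⟩ <;>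
      first
      | lia
      | exact monomial_ext fun _ _ => by
          simp only [descend, expo_mul, expo_pow, expo_zpow]; ring

/-! ### Highest weight monomials and connectedness -/

/-- Since lower and upper sums add up to the weight, `εᵢ` is the maximum of the lower sums minus the
weight. -/
theorem eTilde_eq_none_iff (i : Node) (M : Monomial) :
    eTilde i M = none ↔ ∀ k, lowerSum i M k ≤ wt M i := by
  have h : eTilde i M = none ↔ eps i M = 0 := by
    unfold eTilde
    split_ifs with h0 <;> simp [h0]
  rw [h]
  constructor
  · intro h0 k
    have h1 := neg_upperSum_le_eps i M k
    have h2 := lowerSum_add_upperSum i M k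
    lia
  · intro h0
    obtain ⟨⟨k, hk⟩, -⟩ := isGreatest_eps i M
    have h1 := h0 k
    have h2 := lowerSum_add_upperSum i M k
    have h3 := eps_nonneg i M
    dsimp only at hk
    lia

theorem eTilde_descend_zero (m n : ℕ) (i : Node) :
    eTilde i (descend m n 0 0 0 0 0 0) = none := by
  rw [eTilde_eq_none_iff]
  intro k
  cases i
  · rw [lowerSum_one_descend, wt_one_descend]
    split_ifs <;> lia
  · rw [lowerSum_two_descend, wt_two_descend]
    split_ifs <;> lia

/-- The only highest weight monomial in the polytope is the top one. -/
theorem eq_zero_of_eTilde_eq_none {m n : ℕ} {z₁ x₁ z₂ x₂ z₃ x₃ : ℤ}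
    (hp : InPolytope m n z₁ x₁ z₂ x₂ z₃ x₃)
    (h : ∀ i, eTilde i (descend m n z₁ x₁ z₂ x₂ z₃ x₃) = none) :
    z₁ = 0 ∧ x₁ = 0 ∧ z₂ = 0 ∧ x₂ = 0 ∧ z₃ = 0 ∧ x₃ = 0 := by
  have h1 := (eTilde_eq_none_iff _ _).1 (h .one)
  have h2 := (eTilde_eq_none_iff _ _).1 (h .two)
  simp only [lowerSum_one_descend, wt_one_descend] at h1
  simp only [lowerSum_two_descend, wt_two_descend] at h2
  have a1 := h1 1
  have a2 := h1 0
  have a3 := h1 (-1)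
  have b1 := h2 0
  have b2 := h2 (-1)
  have b3 := h2 (-2)
  norm_num at a1 a2 a3 b1 b2 b3
  obtain ⟨_, _, _, _, _, _, _, _, _, _, _, _⟩ := hp
  -- Tail sums are nonnegative, which forces `x₃`, `z₃`, `x₂`, `z₂`, `x₁`, `z₁` to vanish one after
  -- another in this order.
  lia

theorem top_mem_polytope (m n : ℕ) : Y .one (-1) ^ m * Y .two (-2) ^ n ∈ polytope m n :=
  ⟨0, 0, 0, 0, 0, 0, by constructor <;> simp, (descend_zero m n).symm⟩

/-- The coefficients 3 and 5 are chosen so that the functional is 1 on the weights of both `A₁` and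
`A₂`; it thus measures the depth below the top. -/
theorem three_wt_one_add_five_wt_two_descend (m n : ℕ) (z₁ x₁ z₂ x₂ z₃ x₃ : ℤ) :
    3 * wt (descend m n z₁ x₁ z₂ x₂ z₃ x₃) .one + 5 * wt (descend m n z₁ x₁ z₂ x₂ z₃ x₃) .two =
      3 * m + 5 * n - (x₁ + x₂ + x₃) - (z₁ + z₂ + z₃) := by
  rw [wt_one_descend, wt_two_descend]
  ring

theorem eqvGen_of_mem_polytope {m n : ℕ} (d : ℕ) : ∀ M ∈ polytope m n,
    3 * m + 5 * n - (3 * wt M .one + 5 * wt M .two) ≤ d →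
    Relation.EqvGen Arrow (Y .one (-1) ^ m * Y .two (-2) ^ n) M := by
  induction d with
  | zero =>
    rintro _ ⟨z₁, x₁, z₂, x₂, z₃, x₃, hp, rfl⟩ hd
    rw [three_wt_one_add_five_wt_two_descend] at hd
    obtain ⟨rfl, rfl, rfl, rfl, rfl, rfl⟩ :
        z₁ = 0 ∧ x₁ = 0 ∧ z₂ = 0 ∧ x₂ = 0 ∧ z₃ = 0 ∧ x₃ = 0 := by
      obtain ⟨_, _, _, _, _, _, _, _, _, _, _, _⟩ := hp
      lia
    rw [descend_zero]
    exact .refl _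
  | succ d ih =>
    intro M hM hd
    by_cases hN : ∀ i, eTilde i M = none
    · obtain ⟨z₁, x₁, z₂, x₂, z₃, x₃, hp, rfl⟩ := hM
      obtain ⟨rfl, rfl, rfl, rfl, rfl, rfl⟩ := eq_zero_of_eTilde_eq_none hp hN
      rw [descend_zero]
      exact .refl _
    · push Not at hN
      obtain ⟨i, hi⟩ := hN
      obtain ⟨N, hN⟩ := Option.ne_none_iff_exists'.1 hi
      refine .trans _ N _ (ih N (eTilde_mem_polytope hM hN) ?_)
        (.rel _ _ ⟨i, (fTilde_eq_some_iff_eTilde _ _ _).2 hN⟩)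
      obtain ⟨k, -, -, -, rfl⟩ := (eTilde_eq_some_iff _ _ _).1 hN
      cases i <;> simp [A, wt_Y] at hd ⊢ <;> lia

theorem component_eq_polytope (m n : ℕ) :
    component (Y .one (-1) ^ m * Y .two (-2) ^ n) = polytope m n := by
  refine Set.Subset.antisymm (fun M hM => ?_) fun M hM =>
    eqvGen_of_mem_polytope _ M hM (Int.self_le_toNat _)
  have key : ∀ M N, Relation.EqvGen Arrow M N → (M ∈ polytope m n ↔ N ∈ polytope m n) := by
    intro M N h
    induction h with
    | rel M N h =>
      obtain ⟨i, hi⟩ := h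
      exact ⟨fun h => fTilde_mem_polytope h hi,
        fun h => eTilde_mem_polytope h ((fTilde_eq_some_iff_eTilde _ _ _).1 hi)⟩
    | refl => exact Iff.rfl
    | symm _ _ _ ih => exact ih.symm
    | trans _ _ _ _ _ ih₁ ih₂ => exact ih₁.trans ih₂
  exact (key _ _ hM).1 (top_mem_polytope m n)

/-! ### Tableaux and the polytope -/

/-- The number of entries `≽ x`. -/
def countGE {N : ℕ} (a : Fin N → Letter) (x : Letter) : ℕ :=
  (Finset.univ.filter fun j => x ≤ a j).card

theorem countGE_le {N : ℕ} (a : Fin N → Letter) (x : Letter) : countGE a x ≤ N :=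
  (Finset.card_le_univ _).trans_eq (Fintype.card_fin N)

theorem countGE_anti {N : ℕ} (a : Fin N → Letter) {x y : Letter} (h : x ≤ y) :
    countGE a y ≤ countGE a x :=
  Finset.card_le_card fun _ hj =>
    Finset.mem_filter.2 ⟨Finset.mem_univ _, h.trans (Finset.mem_filter.1 hj).2⟩

/-- In an increasing row the entries `≽ x` fill the last `countGE a x` places. Positions start at 0,
and the additive form avoids truncated subtraction. -/
theorem le_apply_iff {N : ℕ} {a : Fin N → Letter} (ha : Monotone a) (x : Letter) (j : Fin N) :
    x ≤ a j ↔ N ≤ j + countGE a x := by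
  constructor
  · intro h
    have h1 : (Finset.Ici j).card ≤ countGE a x := Finset.card_le_card fun k hk =>
      Finset.mem_filter.2 ⟨Finset.mem_univ _, h.trans (ha (Finset.mem_Ici.1 hk))⟩
    rw [Fin.card_Ici] at h1
    lia
  · intro h
    by_contra hx
    have h1 : countGE a x ≤ (Finset.Ioi j).card := Finset.card_le_card fun k hk => by
      refine Finset.mem_Ioi.2 (lt_of_not_ge fun hkj => hx ?_)
      exact (Finset.mem_filter.1 hk).2.trans (ha hkj)
    rw [Fin.card_Ioi] at h1
    lia

theorem countGE_eq {N P : ℕ} {a : Fin N → Letter} {x : Letter} (hP : P ≤ N)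
    (h : ∀ j, x ≤ a j ↔ N ≤ j + P) : countGE a x = P := by
  unfold countGE
  simp only [h]
  have h1 := Finset.card_filter_add_card_filter_not (s := (Finset.univ : Finset (Fin N)))
    (fun j => (j : ℕ) < N - P)
  rw [Fin.card_filter_val_lt, Finset.card_univ, Fintype.card_fin] at h1
  have h2 : (Finset.univ.filter fun j : Fin N => N ≤ j + P) =
      Finset.univ.filter fun j : Fin N => ¬ (j : ℕ) < N - P :=
    Finset.filter_congr fun j _ => by lia
  rw [h2]
  lia

/-! ### Tableau monomials as quotients by the `Aᵢ(k)` -/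

/-- Along `1, 2, 3, 0, 3̄, 2̄, 1̄` each step divides by one `Aᵢ`; the steps into `0` and into `3̄`
both use `A₁(k+1)`. -/
theorem expo_X (l : Letter) (k : ℤ) (i : Node) (r : ℤ) :
    expo (X l k) i r = expo (Y .one k) i r
      - (if .two ≤ l then 1 else 0) * expo (A .one k) i r
      - (if .three ≤ l then 1 else 0) * expo (A .two k) i r
      - (if .zero ≤ l then 1 else 0) * expo (A .one (k + 1)) i r
      - (if .bar3 ≤ l then 1 else 0) * expo (A .one (k + 1)) i r
      - (if .bar2 ≤ l then 1 else 0) * expo (A .two (k + 1)) i r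
      - (if .bar1 ≤ l then 1 else 0) * expo (A .one (k + 2)) i r := by
  have h2 : k + 1 + 1 = k + 2 := by ring
  have h3 : k + 2 + 1 = k + 3 := by ring
  have hle (x y : Letter) : x ≤ y ↔ x.pos ≤ y.pos := Iff.rfl
  cases l <;> simp [X, A, h2, h3, hle, Letter.pos] <;> ring

theorem expo_prod {ι : Type*} (s : Finset ι) (M : ι → Monomial) (i : Node) (r : ℤ) :
    expo (∏ j ∈ s, M j) i r = ∑ j ∈ s, expo (M j) i r := by
  classical
  induction s using Finset.induction_on with
  | empty => simp
  | insert _ _ h ih => simp [h, ih]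

theorem expo_prod_X {N : ℕ} (a : Fin N → Letter) (k : ℤ) (i : Node) (r : ℤ) :
    expo (∏ j, X (a j) k) i r = N * expo (Y .one k) i r
      - countGE a .two * expo (A .one k) i r
      - countGE a .three * expo (A .two k) i r
      - (countGE a .zero + countGE a .bar3) * expo (A .one (k + 1)) i r
      - countGE a .bar2 * expo (A .two (k + 1)) i r
      - countGE a .bar1 * expo (A .one (k + 2)) i r := by
  rw [expo_prod]
  simp only [expo_X, Finset.sum_sub_distrib, ← Finset.sum_mul, Finset.sum_boole, Finset.sum_const,
    Finset.card_univ, Fintype.card_fin, countGE]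
  simp only [nsmul_eq_mul]
  ring

theorem prod_X_mul_prod_X {m n : ℕ} (a : Fin (m + n) → Letter) (b : Fin n → Letter)
    (hb : countGE b .two = n) :
    (∏ j, X (a j) (-1)) * ∏ j, X (b j) (-2) =
      descend m n (countGE b .three) (countGE a .two + (countGE b .zero + countGE b .bar3))
        (countGE a .three + countGE b .bar2)
        (countGE a .zero + countGE a .bar3 + countGE b .bar1) (countGE a .bar2)
        (countGE a .bar1) := by
  refine monomial_ext fun i r => ?_
  -- All short-row entries are `≽ 2`, so `A₁(-2)` occurs `n` times. It turns `Y₁(-2)ⁿ` into `Y₂(-2)ⁿ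
  -- Y₁(-1)⁻ⁿ`, and the last factor cuts the `Y₁(-1)` power `m + n` of the long row down to `m`.
  have h : expo (A .one (-2)) i r =
      expo (Y .one (-2)) i r + expo (Y .one (-1)) i r - expo (Y .two (-2)) i r := by
    simp [A]
    ring
  rw [expo_mul, expo_prod_X, expo_prod_X, hb]
  norm_num only
  rw [h]
  simp only [descend, expo_mul, expo_pow, expo_zpow]
  push_cast
  ring

/-- The conditions on the numbers `P₂, …` of entries `≽ 2, …` in the long row and the numbers
`Q₃, …` in the short row of a tableau. -/
structure CountsAdmissible (m n P₂ P₃ P₀ P₃' P₂' P₁' Q₃ Q₀ Q₃' Q₂' Q₁' : ℕ) : Prop where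
  P₂_le : P₂ ≤ m + n
  P₃_le : P₃ ≤ P₂
  P₀_le : P₀ ≤ P₃
  P₃'_le : P₃' ≤ P₀
  P₀_le' : P₀ ≤ P₃' + 1
  P₂'_le : P₂' ≤ P₃'
  P₁'_le : P₁' ≤ P₂'
  P₁'_le' : P₁' ≤ m
  Q₃_le : Q₃ ≤ n
  Q₀_le : Q₀ ≤ Q₃
  Q₃'_le : Q₃' ≤ Q₀
  Q₀_le' : Q₀ ≤ Q₃' + 1
  Q₂'_le : Q₂' ≤ Q₃'
  Q₁'_le : Q₁' ≤ Q₂'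
  -- Truncated subtraction is intended: if `P₂ ≤ m`, no column has a long-row entry `≽ 2`, and `Q₀`
  -- must be 0.
  Q₀_le_P₂ : Q₀ ≤ P₂ - m
  Q₂'_le_P₃ : Q₂' ≤ P₃ - m
  Q₁'_le_P₃' : Q₁' ≤ P₃' - m
  P₂_le_Q₃ : P₂ ≤ m + Q₃
  P₃_le_Q₀ : P₃ ≤ m + Q₀
  P₃'_le_Q₂' : P₃' ≤ m + Q₂'
  P₂'_le_Q₁' : P₂' ≤ m + Q₁'
  P₂_le_Q₃' : P₂ ≤ m + Q₃' + 1
  P₃_le_Q₂' : P₃ ≤ m + Q₂' + 1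
  P₀_le_Q₁' : P₀ ≤ m + Q₁' + 1

/-! ### Counts versus exponents -/

theorem CountsAdmissible.inPolytope {m n P₂ P₃ P₀ P₃' P₂' P₁' Q₃ Q₀ Q₃' Q₂' Q₁' : ℕ}
    (h : CountsAdmissible m n P₂ P₃ P₀ P₃' P₂' P₁' Q₃ Q₀ Q₃' Q₂' Q₁') :
    InPolytope m n Q₃ (P₂ + (Q₀ + Q₃')) (P₃ + Q₂') (P₀ + P₃' + Q₁') P₂' P₁' := by
  obtain ⟨_, _, _, _, _, _, _, _, _, _, _, _, _, _, _, _, _, _, _, _, _, _, _, _⟩ := h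
  constructor <;> lia

/-- Admissible counts with a common sum are as equal as possible once the share of the `m` single
boxes is removed, so each sum is split evenly. -/
theorem InPolytope.exists_counts {m n : ℕ} {z₁ x₁ z₂ x₂ z₃ x₃ : ℤ}
    (h : InPolytope m n z₁ x₁ z₂ x₂ z₃ x₃) :
    ∃ P₂ P₃ P₀ P₃' P₂' P₁' Q₃ Q₀ Q₃' Q₂' Q₁' : ℕ,
      CountsAdmissible m n P₂ P₃ P₀ P₃' P₂' P₁' Q₃ Q₀ Q₃' Q₂' Q₁' ∧ z₁ = Q₃ ∧
      x₁ = P₂ + (Q₀ + Q₃') ∧ z₂ = P₃ + Q₂' ∧ x₂ = P₀ + P₃' + Q₁' ∧ z₃ = P₂' ∧ x₃ = P₁' := by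
  obtain ⟨_, _, _, _, _, _, _, _, _, _, _, _⟩ := h
  obtain ⟨P₂, Q₀, Q₃', h1, h2, h3⟩ : ∃ P₂ Q₀ Q₃' : ℕ, x₁ = P₂ + (Q₀ + Q₃') ∧
      (Q₃' ≤ Q₀ ∧ Q₀ ≤ Q₃' + 1) ∧ (Q₀ ≤ P₂ - m ∧ P₂ ≤ m + Q₃' + 1) := by
    by_cases hx : x₁ ≤ m
    · exact ⟨x₁.toNat, 0, 0, by lia⟩
    -- The excess over `m` is cut into three parts differing by at most one, the larger parts first.
    · exact ⟨(m + (x₁ - m + 2) / 3).toNat, ((x₁ - m + 1) / 3).toNat, ((x₁ - m) / 3).toNat, by lia⟩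
  obtain ⟨P₃, Q₂', h4, h5⟩ : ∃ P₃ Q₂' : ℕ, z₂ = P₃ + Q₂' ∧ Q₂' ≤ P₃ - m ∧ P₃ ≤ m + Q₂' + 1 := by
    by_cases hx : z₂ ≤ m
    · exact ⟨z₂.toNat, 0, by lia⟩
    · exact ⟨(m + (z₂ - m + 1) / 2).toNat, ((z₂ - m) / 2).toNat, by lia⟩
  obtain ⟨P₀, P₃', Q₁', h6, h7, h8⟩ : ∃ P₀ P₃' Q₁' : ℕ, x₂ = P₀ + P₃' + Q₁' ∧
      (P₃' ≤ P₀ ∧ P₀ ≤ P₃' + 1) ∧ (Q₁' ≤ P₃' - m ∧ P₀ ≤ m + Q₁' + 1) := by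
    -- Two of the three counts belong to the long row, so the short row is needed only beyond `2 *
    -- m`.
    by_cases hx : x₂ ≤ 2 * m
    · exact ⟨((x₂ + 1) / 2).toNat, (x₂ / 2).toNat, 0, by lia⟩
    · exact ⟨(m + (x₂ - 2 * m + 2) / 3).toNat, (m + (x₂ - 2 * m + 1) / 3).toNat,
        ((x₂ - 2 * m) / 3).toNat, by lia⟩
  refine ⟨P₂, P₃, P₀, P₃', z₃.toNat, x₃.toNat, z₁.toNat, Q₀, Q₃', Q₂', Q₁', ?_,
    by lia, h1, h4, h6, by lia, by lia⟩
  constructor <;> lia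

/-! ### Tableau conditions as threshold conditions -/

/-- Rewrites (ii) and (iii) as implications between thresholds, which translate directly into
inequalities between counts. -/
theorem column_iff (x y : Letter) :
    ((¬ (x = .zero ∧ y = .zero) → x < y) ∧
      (x = .one ∨ x = .zero → Letter.dist x y ≤ 2) ∧
      (¬ (x = .one ∨ x = .zero) → Letter.dist x y ≤ 3)) ↔
    .two ≤ y ∧ (.zero ≤ y → .two ≤ x) ∧ (.bar2 ≤ y → .three ≤ x) ∧ (.bar1 ≤ y → .bar3 ≤ x) ∧
      (.two ≤ x → .three ≤ y) ∧ (.three ≤ x → .zero ≤ y) ∧ (.bar3 ≤ x → .bar2 ≤ y) ∧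
      (.bar2 ≤ x → .bar1 ≤ y) ∧ ¬ .bar1 ≤ x := by
  cases x <;> cases y <;> decide

/-- Distances ignore the order, so `x ≤ z` is kept alongside (iv); in a tableau it follows from `a_j
≼ b_j ≼ b_{j+1}`. The hypothesis covers `x ≽ 2̄`, where (iv) is silent and the column condition
already forces `b_j = 1̄`. -/
theorem next_column_iff (x z : Letter) (h : .bar2 ≤ x → .bar1 ≤ z) :
    ((x = .two ∨ x = .three ∨ x = .zero → 3 ≤ Letter.dist x z) ∧
      (x = .bar3 → 2 ≤ Letter.dist x z)) ∧ x ≤ z ↔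
    (.two ≤ x → .bar3 ≤ z) ∧ (.three ≤ x → .bar2 ≤ z) ∧ (.zero ≤ x → .bar1 ≤ z) := by
  revert h
  cases x <;> cases z <;> decide

theorem eq_zero_iff (x : Letter) : x = .zero ↔ .zero ≤ x ∧ ¬ .bar3 ≤ x := by
  cases x <;> decide

/-- Admissibility of a pair of rows in terms of the numbers of entries. -/
theorem admissible_iff {m n : ℕ} {a : Fin (m + n) → Letter} {b : Fin n → Letter}
    (ha : Monotone a) (hb : Monotone b) :
    Admissible a b ↔ countGE b .two = n ∧
      CountsAdmissible m n (countGE a .two) (countGE a .three) (countGE a .zero)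
        (countGE a .bar3) (countGE a .bar2) (countGE a .bar1) (countGE b .three)
        (countGE b .zero) (countGE b .bar3) (countGE b .bar2) (countGE b .bar1) := by
  have hA (x : Letter) (j : Fin n) :
      x ≤ a (j.castLE (Nat.le_add_left n m)) ↔ m + n ≤ j + countGE a x := le_apply_iff ha x _
  have hB (x : Letter) (j : Fin n) : x ≤ b j ↔ n ≤ j + countGE b x := le_apply_iff hb x j
  have la : countGE a .two ≤ m + n := countGE_le _ _
  have lb : countGE b .two ≤ n := countGE_le _ _
  have a1 : countGE a .three ≤ countGE a .two := countGE_anti a (by decide)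
  have a2 : countGE a .zero ≤ countGE a .three := countGE_anti a (by decide)
  have a3 : countGE a .bar3 ≤ countGE a .zero := countGE_anti a (by decide)
  have a4 : countGE a .bar2 ≤ countGE a .bar3 := countGE_anti a (by decide)
  have a5 : countGE a .bar1 ≤ countGE a .bar2 := countGE_anti a (by decide)
  have b1 : countGE b .three ≤ countGE b .two := countGE_anti b (by decide)
  have b2 : countGE b .zero ≤ countGE b .three := countGE_anti b (by decide)
  have b3 : countGE b .bar3 ≤ countGE b .zero := countGE_anti b (by decide)
  have b4 : countGE b .bar2 ≤ countGE b .bar3 := countGE_anti b (by decide)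
  have b5 : countGE b .bar1 ≤ countGE b .bar2 := countGE_anti b (by decide)
  constructor
  · intro h
    have hcol (j : ℕ) (hj : j < n) := (column_iff _ _).1
      ⟨h.column ⟨j, hj⟩, h.dist_le_two ⟨j, hj⟩, h.dist_le_three ⟨j, hj⟩⟩
    have hnext (j : ℕ) (hj : j + 1 < n) := by
      have hjj : b ⟨j, by lia⟩ ≤ b ⟨j + 1, hj⟩ := hb (Fin.mk_le_mk.2 (by lia))
      have hc := hcol j (by lia)
      have hle : a (Fin.castLE (Nat.le_add_left n m) ⟨j, by lia⟩) ≤ b ⟨j, by lia⟩ := by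
        by_cases h0 : a (Fin.castLE (Nat.le_add_left n m) ⟨j, by lia⟩) = .zero ∧
            b ⟨j, by lia⟩ = .zero
        · rw [h0.1, h0.2]
        · exact (h.column ⟨j, by lia⟩ h0).le
      exact (next_column_iff _ (b ⟨j + 1, hj⟩)
        fun h1 => (hc.2.2.2.2.2.2.2.1 h1).trans hjj).1
        ⟨⟨h.three_le_dist ⟨j, by lia⟩ ⟨j + 1, hj⟩ rfl, h.two_le_dist ⟨j, by lia⟩ ⟨j + 1, hj⟩ rfl⟩,
          hle.trans hjj⟩
    simp only [hA, hB] at hcol hnext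
    have za (j : ℕ) (hj : j + 1 < m + n) : ¬ (m + n ≤ j + countGE a .zero ∧
        ¬ m + n ≤ j + 1 + countGE a .bar3) := fun h0 => by
      have := h.zero_a ⟨j, by lia⟩ ⟨j + 1, hj⟩
      simp only [eq_zero_iff, le_apply_iff ha, Fin.mk.injEq] at this
      lia
    have zb (j : ℕ) (hj : j + 1 < n) : ¬ (n ≤ j + countGE b .zero ∧
        ¬ n ≤ j + 1 + countGE b .bar3) := fun h0 => by
      have := h.zero_b ⟨j, by lia⟩ ⟨j + 1, hj⟩
      simp only [eq_zero_iff, hB, Fin.mk.injEq] at this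
      lia
    -- The first short-row entry is `≽ 2` by its column, hence all are.
    have hQ₂ : countGE b .two = n := by
      by_contra
      have := hcol 0 (by lia)
      lia
    -- Each remaining inequality, if false, is refuted at the position where the relevant block of
    -- entries `≽ x` begins.
    refine ⟨hQ₂, la, a1, a2, a3, ?_, a4, a5, ?_, by lia, b2, b3, ?_, b4, b5,
      ?_, ?_, ?_, ?_, ?_, ?_, ?_, ?_, ?_, ?_⟩ <;> by_contra
    · have := za (m + n - countGE a .zero) (by lia)
      lia
    · have := hcol (m + n - countGE a .bar1) (by lia)
      lia
    · have := zb (n - countGE b .zero) (by lia)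
      lia
    · have := hcol (n - countGE b .zero) (by lia)
      lia
    · have := hcol (n - countGE b .bar2) (by lia)
      lia
    · have := hcol (n - countGE b .bar1) (by lia)
      lia
    · have := hcol (m + n - countGE a .two) (by lia)
      lia
    · have := hcol (m + n - countGE a .three) (by lia)
      lia
    · have := hcol (m + n - countGE a .bar3) (by lia)
      lia
    · have := hcol (m + n - countGE a .bar2) (by lia)
      lia
    · have := hnext (m + n - countGE a .two) (by lia)
      lia
    · have := hnext (m + n - countGE a .three) (by lia)
      lia
    · have := hnext (m + n - countGE a .zero) (by lia)
      lia
  · rintro ⟨hQ₂, h⟩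
    obtain ⟨_, _, _, _, _, _, _, _, _, _, _, _, _, _, _, _, _, _, _, _, _, _, _, _⟩ := h
    have hcol (j : Fin n) := (column_iff (a (j.castLE (Nat.le_add_left n m))) (b j)).2 (by
      simp only [hA, hB]
      have := j.isLt
      refine ⟨?_, ?_, ?_, ?_, ?_, ?_, ?_, ?_, ?_⟩ <;> lia)
    have hnext (j k : Fin n) (hjk : (j : ℕ) + 1 = k) :=
      (next_column_iff (a (j.castLE (Nat.le_add_left n m))) (b k)
        (by simp only [hA, hB]; lia)).2 (by
          simp only [hA, hB]
          refine ⟨?_, ?_, ?_⟩ <;> lia)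
    refine ⟨ha, hb, fun j k hj hk => ?_, fun j k hj hk => ?_, fun j => (hcol j).1,
      fun j => (hcol j).2.1, fun j => (hcol j).2.2, fun j k hjk => (hnext j k hjk).1.1,
      fun j k hjk => (hnext j k hjk).1.2⟩
    · rw [eq_zero_iff, le_apply_iff ha, le_apply_iff ha] at hj hk
      exact Fin.ext (by lia)
    · rw [eq_zero_iff, hB, hB] at hj hk
      exact Fin.ext (by lia)

/-- There is a row with prescribed numbers of entries. -/
theorem exists_row {N P₂ P₃ P₀ P₃' P₂' P₁' : ℕ} (h₂ : P₂ ≤ N) (h₃ : P₃ ≤ P₂) (h₀ : P₀ ≤ P₃)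
    (h₃' : P₃' ≤ P₀) (h₂' : P₂' ≤ P₃') (h₁' : P₁' ≤ P₂') :
    ∃ a : Fin N → Letter, Monotone a ∧ countGE a .two = P₂ ∧ countGE a .three = P₃ ∧
      countGE a .zero = P₀ ∧ countGE a .bar3 = P₃' ∧ countGE a .bar2 = P₂' ∧
      countGE a .bar1 = P₁' := by
  obtain ⟨f, hf⟩ : ∃ f : ℕ → Letter, ∀ j,
      (.two ≤ f j ↔ N ≤ j + P₂) ∧ (.three ≤ f j ↔ N ≤ j + P₃) ∧ (.zero ≤ f j ↔ N ≤ j + P₀) ∧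
      (.bar3 ≤ f j ↔ N ≤ j + P₃') ∧ (.bar2 ≤ f j ↔ N ≤ j + P₂') ∧
      (.bar1 ≤ f j ↔ N ≤ j + P₁') := by
    refine ⟨fun j => if N ≤ j + P₁' then .bar1 else if N ≤ j + P₂' then .bar2 else
      if N ≤ j + P₃' then .bar3 else if N ≤ j + P₀ then .zero else if N ≤ j + P₃ then .three else
      if N ≤ j + P₂ then .two else .one, fun j => ?_⟩
    have hle (x y : Letter) : x ≤ y ↔ x.pos ≤ y.pos := Iff.rfl
    simp only [hle]
    split_ifs <;> simp only [Letter.pos] <;> lia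
  have hmono : Monotone f := by
    intro j k hjk
    have h1 := hf j
    have h2 := hf k
    -- The order on letters is detected by the thresholds above `1`.
    have key : ∀ x y : Letter, (.two ≤ x → .two ≤ y) → (.three ≤ x → .three ≤ y) →
        (.zero ≤ x → .zero ≤ y) → (.bar3 ≤ x → .bar3 ≤ y) → (.bar2 ≤ x → .bar2 ≤ y) →
        (.bar1 ≤ x → .bar1 ≤ y) → x ≤ y := by
      intro x y
      cases x <;> cases y <;> decide
    refine key _ _ ?_ ?_ ?_ ?_ ?_ ?_ <;> lia
  exact ⟨fun j => f j, fun j k h => hmono h, countGE_eq (by lia) fun j => (hf j).1,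
    countGE_eq (by lia) fun j => (hf j).2.1, countGE_eq (by lia) fun j => (hf j).2.2.1,
    countGE_eq (by lia) fun j => (hf j).2.2.2.1, countGE_eq (by lia) fun j => (hf j).2.2.2.2.1,
    countGE_eq (by lia) fun j => (hf j).2.2.2.2.2⟩

theorem polytope_eq_setOf_admissible (m n : ℕ) :
    polytope m n = {M : Monomial | ∃ (a : Fin (m + n) → Letter) (b : Fin n → Letter),
      Admissible a b ∧ M = (∏ j, X (a j) (-1)) * ∏ j, X (b j) (-2)} := by
  ext M
  constructor
  · rintro ⟨z₁, x₁, z₂, x₂, z₃, x₃, hp, rfl⟩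
    obtain ⟨P₂, P₃, P₀, P₃', P₂', P₁', Q₃, Q₀, Q₃', Q₂', Q₁', hc, rfl, rfl, rfl, rfl, rfl, rfl⟩ :=
      hp.exists_counts
    obtain ⟨a, ha, rfl, rfl, rfl, rfl, rfl, rfl⟩ :=
      exists_row hc.P₂_le hc.P₃_le hc.P₀_le hc.P₃'_le hc.P₂'_le hc.P₁'_le
    obtain ⟨b, hb, hQ₂, rfl, rfl, rfl, rfl, rfl⟩ :=
      exists_row le_rfl hc.Q₃_le hc.Q₀_le hc.Q₃'_le hc.Q₂'_le hc.Q₁'_le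
    exact ⟨a, b, (admissible_iff ha hb).2 ⟨hQ₂, hc⟩, (prod_X_mul_prod_X a b hQ₂).symm⟩
  · rintro ⟨a, b, hab, rfl⟩
    obtain ⟨hQ₂, hc⟩ := (admissible_iff hab.mono_a hab.mono_b).1 hab
    exact ⟨_, _, _, _, _, _, hc.inPolytope, prod_X_mul_prod_X a b hQ₂⟩

end G2Crystal

theorem mainTheorem4 (m n : ℕ) :
    wt (Y .one (-1) ^ m * Y .two (-2) ^ n) =
        m • fundamentalWeight .one + n • fundamentalWeight .two ∧
      (∀ i : Node, eTilde i (Y .one (-1) ^ m * Y .two (-2) ^ n) = none) ∧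
      Y .one (-1) ^ m * Y .two (-2) ^ n = X .one (-1) ^ m * (X .one (-1) * X .two (-2)) ^ n ∧
      component (Y .one (-1) ^ m * Y .two (-2) ^ n) =
        {M : Monomial | ∃ (a : Fin (m + n) → Letter) (b : Fin n → Letter),
          Admissible a b ∧ M = (∏ j, X (a j) (-1)) * ∏ j, X (b j) (-2)} := by
  refine ⟨?_, fun i => ?_, ?_, ?_⟩
  · ext i
    cases i <;> simp [wt_Y, fundamentalWeight]
  · rw [← descend_zero]
    exact eTilde_descend_zero m n i
  · simp [X]
  · rw [component_eq_polytope, polytope_eq_setOf_admissible]
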